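/- **Setting.** Let $\Phi^{-1}$ be the quantile function of the standard normal distribution. On a probability space let $Y\sim\mathcal N(\mu,\eta^2)$, $\eta>0$, be a welfare outcome. A *Gaussian predictor* of $Y$ is a random variable $\hat Y$ such that the error $Y-\hat Y\sim\mathcal N(0,\gamma^2)$ ($\gamma\ge 0$) is independent of $\hat Y$; its quality is $R^2=\operatorname{corr}(Y,\hat Y)^2$. For a screening capacity $\alpha$ and a worst-off fraction $\beta$, with $q_Y(\beta)$ the $\beta$-quantile of $Y$, the policy value is $$V(\alpha,\beta,R^2)=\max_{\pi:\mathbb R\to\{0,1\}}\ \Pr\big[\pi(\hat Y)=1\,\big|\,Y\le q_Y(\beta)\big]\quad\text{subject to}\quad \mathbb E[\pi(\hat Y)]\le\alpha ,$$ which depends on the model only through $R^2$. The prediction-access ratio is $$\mathrm{PAR}=\frac{V(\alpha+\Delta_\alpha,\beta,R^2)-V(\alpha,\beta,R^2)}{V(\alpha,\beta,R^2+\Delta_{R^2})-V(\alpha,\beta,R^2)} .$$ **Theorem (PAR for small screening capacities).** Let $0<R^2<1$, $\Delta_{R^2}>0$ with $R^2+\Delta_{R^2}\le 1$, and $0<\beta\le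 0.5$. There exist a threshold $t=t(\beta,R^2,\Delta_{R^2})\in(0,1/2)$ and a function $e(\alpha)$ (depending on $\beta,R^2,\Delta_{R^2}$ only) with $e(\alpha)\to0$ as $\alpha\downarrow0$, such that for all $\alpha,\Delta_\alpha>0$ with $\alpha+\Delta_\alpha\le t$ the denominator of $\mathrm{PAR}$ is positive and $$\mathrm{PAR}\ \ge\ \frac{\Delta_\alpha}{\Delta_{R^2}}\sqrt{R^2(1-R^2)}\,\big(5.1\,\alpha\,\Phi^{-1}(1-\alpha)\big)^{-\frac1{1-R^2}+e(\alpha)} .$$ Consequently the ratio blows up polynomially in $1/\alpha$: for every $\delta>0$ there is $a_\delta>0$ (depending on $\beta,R^2,\Delta_{R^2},\delta$ only) such that $\mathrm{PAR}\ge\frac{\Delta_\alpha}{\Delta_{R^2}}\,(1/\alpha)^{\frac1{1-R^2}-\delta}$ for all $0<\alpha\le a_\delta$ and $\Delta_\alpha>0$ with $\alpha+\Delta_\alpha\le t$. -/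

import Mathlib

open MeasureTheory ProbabilityTheory Filter Topology

namespace Screening

/-- The `p`-quantile of a measure on the line, `inf {x | p ≤ F x}` with `F` its distribution
function (meant for `0 < p < 1`). -/
noncomputable def quantile (ν : Measure ℝ) (p : ℝ) : ℝ :=
  sInf {x : ℝ | p ≤ cdf ν x}

/-- The quantile function `Φ⁻¹` of the standard normal distribution. -/
noncomputable def stdNormalQuantile (p : ℝ) : ℝ :=
  quantile (gaussianReal 0 1) p

section

variable {Ω : Type*} [MeasurableSpace Ω]

/-- The coefficient of determination: the squared correlation of the outcome `Y` and the
prediction `Yhat`. -/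
noncomputable def rSquared (P : Measure Ω) (Y Yhat : Ω → ℝ) : ℝ :=
  (covariance Y Yhat P / (Real.sqrt (variance Y P) * Real.sqrt (variance Yhat P))) ^ 2

/-- The Gaussian model: the welfare outcome `Y` is normal (and not constant), the error
`Y - Yhat` is centred normal and independent of the prediction `Yhat`. The error variance `0`,
that is perfect prediction, is allowed. -/
structure IsGaussianModel (P : Measure Ω) (Y Yhat : Ω → ℝ) : Prop where
  measurable_outcome : Measurable Y
  measurable_prediction : Measurable Yhat
  outcome_law : ∃ (μ : ℝ) (η : NNReal), 0 < η ∧ P.map Y = gaussianReal μ (η ^ 2)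
  error_law : ∃ γ : NNReal, P.map (fun ω => Y ω - Yhat ω) = gaussianReal 0 (γ ^ 2)
  error_indep : IndepFun (fun ω => Y ω - Yhat ω) Yhat P

/-- A screening policy (`true` means "screen") based on the prediction is feasible at capacity `a`
if it screens at most a fraction `a` of the population. -/
def IsFeasible (P : Measure Ω) (Yhat : Ω → ℝ) (a : ℝ) (π : ℝ → Bool) : Prop :=
  Measurable π ∧ P.real {ω | π (Yhat ω) = true} ≤ a

/-- The worst-off `b` fraction of the population. -/
def worstOff (P : Measure Ω) (Y : Ω → ℝ) (b : ℝ) : Set Ω :=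
  {ω | Y ω ≤ quantile (P.map Y) b}

/-- The fraction of the worst-off who are screened by the policy `π`. -/
noncomputable def screenedFraction (P : Measure Ω) (Y Yhat : Ω → ℝ) (b : ℝ) (π : ℝ → Bool) : ℝ :=
  (ProbabilityTheory.cond P (worstOff P Y b)).real {ω | π (Yhat ω) = true}

/-- The policy value `V` at capacity `a` and worst-off fraction `b`: the optimal value of the
screening problem. -/
noncomputable def policyValue (P : Measure Ω) (Y Yhat : Ω → ℝ) (a b : ℝ) : ℝ :=
  sSup (screenedFraction P Y Yhat b '' {π | IsFeasible P Yhat a π})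

/-- The prediction-access ratio: the gain in policy value from raising the capacity from `a` to
`a + Δa` with the prediction `Yhat`, over the gain from replacing `Yhat` by `Yhat'` at
capacity `a`. -/
noncomputable def predictionAccessRatio (P : Measure Ω) (Y Yhat Yhat' : Ω → ℝ)
    (a Δa b : ℝ) : ℝ :=
  (policyValue P Y Yhat (a + Δa) b - policyValue P Y Yhat a b) /
    (policyValue P Y Yhat' a b - policyValue P Y Yhat a b)

end

end Screening

namespace Screening

/-! After standardization, (Ŷ, Y) is an affine image of (x, ρx + σw) with x, w independent standard
normal, ρ² = R² and σ² = 1 − R². An optimal policy screens below a threshold z of x, so βV is the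
mass of worst-off people captured below z. Captured and wasted mass add up to the capacity α.

Hence β times the denominator of PAR is the reduction in wasted mass, which is at most the mass W
wasted by the original predictor. For small capacity, anyone near the threshold is worst-off with
probability at least 1/2, so β times the numerator is at least Δα/2. This gives PAR ≥ Δα/(2W)
(`IsGaussianModel.predictionAccessRatio_ge`).

With z = −s, waste requires x ≤ −s and w > (b + ρs)/σ, where b = Φ⁻¹(β). So W ≤ exp(−h) with h ~ (1
+ ρ²/σ²)s²/2 = s²/(2(1 − R²)), while log α ~ −s²/2. Thus 1/W ≥ α^(−1/(1−R²)+o(1)). The denominator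
is positive because a larger R² makes the wasted mass decay with a strictly larger coefficient of s²
(`eventually_wastedMass_lt`). -/

/-! ### Distribution function, quantiles and tails of the normal law. -/

/-- The standard normal distribution. -/
noncomputable abbrev stdGaussian : Measure ℝ := gaussianReal 0 1

instance : NullSingletonClass stdGaussian := nullSingletonClass_gaussianReal one_ne_zero

lemma strictMono_cdf_stdGaussian : StrictMono (cdf stdGaussian) := by
  intro x y hxy
  rw [cdf_eq_real, cdf_eq_real, ← Set.Iic_union_Ioc_eq_Iic hxy.le,
    measureReal_union (Set.Iic_disjoint_Ioc le_rfl) measurableSet_Ioc]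
  -- Lebesgue measure is absolutely continuous with respect to the Gaussian, so a Gaussian-null
  -- interval would have length zero.
  have : stdGaussian (Set.Ioc x y) ≠ 0 := by
    intro h
    have := gaussianReal_absolutelyContinuous' 0 (one_ne_zero (α := NNReal)) h
    simp at this
    linarith
  have : 0 < stdGaussian.real (Set.Ioc x y) :=
    ENNReal.toReal_pos this (measure_ne_top _ _)
  linarith

lemma continuous_cdf (ν : Measure ℝ) [IsProbabilityMeasure ν] [NullSingletonClass ν] :
    Continuous (cdf ν) := by
  rw [continuous_iff_continuousAt]
  intro x
  rw [(monotone_cdf ν).continuousAt_iff_leftLim_eq_rightLim, StieltjesFunction.rightLim_eq]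
  have h : (cdf ν).measure {x} = 0 := by rw [measure_cdf, measure_singleton]
  rw [StieltjesFunction.measure_singleton, ENNReal.ofReal_eq_zero] at h
  exact le_antisymm ((monotone_cdf ν).leftLim_le le_rfl) (by linarith)

lemma exists_cdf_stdGaussian_eq {p : ℝ} (h0 : 0 < p) (h1 : p < 1) :
    ∃ x, cdf stdGaussian x = p := by
  have hc := continuous_cdf stdGaussian
  obtain ⟨x, hx⟩ := ((tendsto_cdf_atBot stdGaussian).eventually_lt_const h0).exists
  obtain ⟨y, hy⟩ := ((tendsto_cdf_atTop stdGaussian).eventually_const_lt h1).exists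
  exact mem_range_of_exists_le_of_exists_ge hc ⟨x, hx.le⟩ ⟨y, hy.le⟩

lemma stdNormalQuantile_cdf (x : ℝ) : stdNormalQuantile (cdf stdGaussian x) = x := by
  have : {y : ℝ | cdf stdGaussian x ≤ cdf (gaussianReal 0 1) y} = Set.Ici x := by
    ext y
    exact strictMono_cdf_stdGaussian.le_iff_le
  rw [stdNormalQuantile, quantile, this, csInf_Ici]

lemma cdf_stdNormalQuantile {p : ℝ} (h0 : 0 < p) (h1 : p < 1) :
    cdf stdGaussian (stdNormalQuantile p) = p := by
  obtain ⟨x, rfl⟩ := exists_cdf_stdGaussian_eq h0 h1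
  rw [stdNormalQuantile_cdf]

lemma gaussianReal_eq_map_stdGaussian (μ : ℝ) (η : NNReal) :
    gaussianReal μ (η ^ 2) = stdGaussian.map (fun x => μ + η * x) := by
  have : (fun x : ℝ => μ + η * x) = (fun x => μ + x) ∘ (fun x => (η : ℝ) * x) := rfl
  rw [this, ← Measure.map_map (by fun_prop) (by fun_prop), gaussianReal_map_const_mul,
    gaussianReal_map_const_add]
  congr 1
  · simp
  · ext; simp

lemma quantile_gaussianReal (μ : ℝ) {η : NNReal} (hη : 0 < η) {p : ℝ} (h0 : 0 < p) (h1 : p < 1) :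
    quantile (gaussianReal μ (η ^ 2)) p = μ + η * stdNormalQuantile p := by
  have hη' : (0 : ℝ) < η := hη
  have : {y : ℝ | p ≤ cdf (gaussianReal μ (η ^ 2)) y} =
      Set.Ici (μ + η * stdNormalQuantile p) := by
    ext y
    have h : cdf (gaussianReal μ (η ^ 2)) y = cdf stdGaussian ((y - μ) / η) := by
      rw [cdf_eq_real, cdf_eq_real, gaussianReal_eq_map_stdGaussian,
        map_measureReal_apply (by fun_prop) measurableSet_Iic]
      congr 1
      ext x
      simp only [Set.mem_preimage, Set.mem_Iic, le_div_iff₀ hη']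
      constructor <;> intro h <;> linarith
    rw [Set.mem_ofPred_eq, h, Set.mem_Ici]
    nth_rewrite 1 [← cdf_stdNormalQuantile h0 h1]
    rw [strictMono_cdf_stdGaussian.le_iff_le, le_div_iff₀ hη']
    constructor <;> intro h <;> linarith
  rw [quantile, this, csInf_Ici]

lemma stdGaussian_real_Ioi (x : ℝ) : stdGaussian.real (Set.Ioi x) = cdf stdGaussian (-x) := by
  have h : stdGaussian.map (fun x => -x) = stdGaussian := by
    rw [gaussianReal_map_neg, neg_zero]
  rw [cdf_eq_real]
  nth_rewrite 2 [← h]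
  rw [map_measureReal_apply (by fun_prop) measurableSet_Iic]
  have : (fun x : ℝ => -x) ⁻¹' Set.Iic (-x) = Set.Ici x := by ext; simp
  rw [this]
  exact (measureReal_congr Ioi_ae_eq_Ici)

lemma cdf_stdGaussian_neg (x : ℝ) : cdf stdGaussian (-x) = 1 - cdf stdGaussian x := by
  rw [← stdGaussian_real_Ioi, ← Set.compl_Iic, probReal_compl_eq_one_sub measurableSet_Iic,
    cdf_eq_real]

lemma cdf_stdGaussian_zero : cdf stdGaussian 0 = 1 / 2 := by
  have := cdf_stdGaussian_neg 0
  rw [neg_zero] at this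
  linarith

lemma cdf_stdGaussian_pos (x : ℝ) : 0 < cdf stdGaussian x :=
  (cdf_nonneg _ (x - 1)).trans_lt (strictMono_cdf_stdGaussian (by linarith))

lemma cdf_stdGaussian_lt_one (x : ℝ) : cdf stdGaussian x < 1 :=
  (strictMono_cdf_stdGaussian (by linarith : x < x + 1)).trans_le (cdf_le_one _ (x + 1))

lemma stdNormalQuantile_one_sub {p : ℝ} (h0 : 0 < p) (h1 : p < 1) :
    stdNormalQuantile (1 - p) = -stdNormalQuantile p := by
  apply strictMono_cdf_stdGaussian.injective
  rw [cdf_stdNormalQuantile (by linarith) (by linarith), cdf_stdGaussian_neg,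
    cdf_stdNormalQuantile h0 h1]

/-- The Gaussian tail is at most `exp (-s² / 2)`. -/
lemma cdf_stdGaussian_neg_le {s : ℝ} (hs : 0 ≤ s) :
    cdf stdGaussian (-s) ≤ Real.exp (-s ^ 2 / 2) := by
  -- Chernoff bound with variance proxy 1.
  have h : HasSubgaussianMGF (id : ℝ → ℝ) 1 stdGaussian :=
    ⟨fun t => integrable_exp_mul_gaussianReal t, fun t => by
      rw [mgf_id_gaussianReal]
      simp⟩
  have := h.measure_ge_le hs
  rw [← stdGaussian_real_Ioi, measureReal_congr Ioi_ae_eq_Ici]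
  have h' : (Set.Ici s) = {ω | s ≤ id ω} := rfl
  rw [h']
  simpa using this

/-- On this interval of length one the density is smallest at the far end. The shift from s to s + 1
changes the exponent only by O(s), which is harmless on the scale s². -/
lemma le_stdGaussian_real_Icc {s : ℝ} (hs : 0 ≤ s) :
    (Real.sqrt (2 * Real.pi))⁻¹ * Real.exp (-(s + 1) ^ 2 / 2) ≤
      stdGaussian.real (Set.Icc (-(s + 1)) (-s)) := by
  rw [measureReal_def, gaussianReal_apply_eq_integral 0 one_ne_zero, ENNReal.toReal_ofReal
    (integral_nonneg fun x => gaussianPDFReal_nonneg 0 1 x)]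
  have : ∫ _ in Set.Icc (-(s + 1)) (-s), (Real.sqrt (2 * Real.pi))⁻¹ * Real.exp (-(s + 1) ^ 2 / 2)
      = (Real.sqrt (2 * Real.pi))⁻¹ * Real.exp (-(s + 1) ^ 2 / 2) := by
    rw [setIntegral_const, Real.volume_real_Icc_of_le (by linarith)]
    simp
  rw [← this]
  refine setIntegral_mono_on (integrableOn_const (by simp)) (integrable_gaussianPDFReal 0 1).integrableOn
    measurableSet_Icc fun x hx => ?_
  rw [gaussianPDFReal]
  simp only [NNReal.coe_one, mul_one, sub_zero]
  have : x ^ 2 ≤ (s + 1) ^ 2 := sq_le_sq' hx.1 (by linarith [hx.2])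
  gcongr

lemma le_cdf_stdGaussian_neg {s : ℝ} (hs : 0 ≤ s) :
    (Real.sqrt (2 * Real.pi))⁻¹ * Real.exp (-(s + 1) ^ 2 / 2) ≤ cdf stdGaussian (-s) := by
  rw [cdf_eq_real]
  exact (le_stdGaussian_real_Icc hs).trans (measureReal_mono fun x hx => hx.2)

/-! ### Captured and wasted mass of a threshold policy. -/

/-- For independent standard normal `x`, `w`: the mass of the event that the prediction `x` is at
most `z` and the outcome `ρ * x + σ * w` is at most `b`. -/
noncomputable def capturedMass (ρ σ b z : ℝ) : ℝ :=
  (stdGaussian.prod stdGaussian).real {p | p.1 ≤ z ∧ ρ * p.1 + σ * p.2 ≤ b}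

/-- For independent standard normal `x`, `w`: the mass of the event that the prediction `x` is at
most `z` and the outcome `ρ * x + σ * w` exceeds `b`. -/
noncomputable def wastedMass (ρ σ b z : ℝ) : ℝ :=
  (stdGaussian.prod stdGaussian).real {p | p.1 ≤ z ∧ b < ρ * p.1 + σ * p.2}

lemma capturedMass_add_wastedMass (ρ σ b z : ℝ) :
    capturedMass ρ σ b z + wastedMass ρ σ b z = cdf stdGaussian z := by
  have h : (stdGaussian.prod stdGaussian).real (Set.Iic z ×ˢ Set.univ) = cdf stdGaussian z := by
    rw [measureReal_prod_prod, cdf_eq_real]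
    simp
  rw [← h, capturedMass, wastedMass, ← measureReal_union]
  · congr 1
    ext p
    simp only [Set.mem_union, Set.mem_ofPred_eq, Set.mem_prod, Set.mem_Iic, Set.mem_univ, and_true,
      ← and_or_left, le_or_gt]
  · rw [Set.disjoint_left]
    intro p hp hp'
    exact absurd hp.2 (not_le.2 hp'.2)
  · exact (measurable_fst measurableSet_Iic).inter
      (measurableSet_lt (f := fun _ : ℝ × ℝ => b) (by fun_prop) (by fun_prop))

lemma wastedMass_nonneg (ρ σ b z : ℝ) : 0 ≤ wastedMass ρ σ b z := measureReal_nonneg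

/-- The event lies in a product of two tails, since x ≤ −s forces σw > b + ρs. -/
lemma wastedMass_le {ρ σ b s : ℝ} (hρ : 0 ≤ ρ) (hσ : 0 < σ) (hs : 0 ≤ s) (hb : 0 ≤ b + ρ * s) :
    wastedMass ρ σ b (-s) ≤ Real.exp (-s ^ 2 / 2) * Real.exp (-((b + ρ * s) / σ) ^ 2 / 2) := by
  calc wastedMass ρ σ b (-s)
      ≤ (stdGaussian.prod stdGaussian).real (Set.Iic (-s) ×ˢ Set.Ioi ((b + ρ * s) / σ)) := by
        refine measureReal_mono fun p hp => ⟨hp.1, ?_⟩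
        rw [Set.mem_Ioi, div_lt_iff₀ hσ]
        nlinarith [hp.1, hp.2, mul_le_mul_of_nonneg_left hp.1 hρ]
    _ = cdf stdGaussian (-s) * cdf stdGaussian (-((b + ρ * s) / σ)) := by
        rw [measureReal_prod_prod, ← cdf_eq_real, stdGaussian_real_Ioi]
    _ ≤ _ := mul_le_mul (cdf_stdGaussian_neg_le hs) (cdf_stdGaussian_neg_le (by positivity))
        (cdf_nonneg _ _) (Real.exp_pos _).le

/-- The event contains a rectangle with x in a unit interval below −s. Its exponent has the same s²
coefficient as that of `wastedMass_le`. -/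
lemma le_wastedMass {ρ σ b s : ℝ} (hρ : 0 ≤ ρ) (hσ : 0 < σ) (hs : 0 ≤ s) (hb : 0 ≤ b + ρ * s) :
    ((Real.sqrt (2 * Real.pi))⁻¹ * Real.exp (-(s + 1) ^ 2 / 2)) *
      ((Real.sqrt (2 * Real.pi))⁻¹ * Real.exp (-((b + ρ * (s + 1)) / σ + 1) ^ 2 / 2)) ≤
      wastedMass ρ σ b (-s) := by
  calc _ ≤ stdGaussian.real (Set.Icc (-(s + 1)) (-s)) *
        cdf stdGaussian (-((b + ρ * (s + 1)) / σ)) := by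
        refine mul_le_mul (le_stdGaussian_real_Icc hs)
          (le_cdf_stdGaussian_neg (div_nonneg (by linarith) hσ.le)) (by positivity)
          measureReal_nonneg
    _ = (stdGaussian.prod stdGaussian).real
        (Set.Icc (-(s + 1)) (-s) ×ˢ Set.Ioi ((b + ρ * (s + 1)) / σ)) := by
        rw [measureReal_prod_prod, stdGaussian_real_Ioi]
    _ ≤ wastedMass ρ σ b (-s) := by
        refine measureReal_mono fun p hp => ⟨hp.1.2, ?_⟩
        have h := hp.2
        rw [Set.mem_Ioi, div_lt_iff₀ hσ] at h
        nlinarith [hp.1.1, mul_le_mul_of_nonneg_left hp.1.1 hρ]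

lemma wastedMass_one_zero {b z : ℝ} (h : z ≤ b) : wastedMass 1 0 b z = 0 := by
  have : {p : ℝ × ℝ | p.1 ≤ z ∧ b < 1 * p.1 + 0 * p.2} = ∅ := by
    ext p
    simp only [Set.mem_ofPred_eq, Set.mem_empty_iff_false, iff_false, not_and, not_lt]
    intro hp
    linarith
  rw [wastedMass, this, measureReal_empty]

/-- Raising the threshold from `z` to `z'` captures at least half of the additional mass, as long
as the prediction at the threshold still puts the expected outcome below `b`. -/
lemma capturedMass_sub_ge {ρ σ b z z' : ℝ} (hρ : 0 ≤ ρ) (hσ : 0 ≤ σ) (hz : z ≤ z')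
    (hb : ρ * z' ≤ b) :
    (cdf stdGaussian z' - cdf stdGaussian z) / 2 ≤
      capturedMass ρ σ b z' - capturedMass ρ σ b z := by
  have h1 : cdf stdGaussian z' - cdf stdGaussian z = stdGaussian.real (Set.Ioc z z') := by
    rw [cdf_eq_real, cdf_eq_real, ← Set.Iic_union_Ioc_eq_Iic hz,
      measureReal_union (Set.Iic_disjoint_Ioc le_rfl) measurableSet_Ioc]
    ring
  have h2 : (stdGaussian.prod stdGaussian).real (Set.Ioc z z' ×ˢ Set.Iic 0) =
      stdGaussian.real (Set.Ioc z z') / 2 := by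
    rw [measureReal_prod_prod, ← cdf_eq_real stdGaussian 0, cdf_stdGaussian_zero]
    ring
  -- For x ≤ z' one has ρx ≤ b, so w ≤ 0, an event of probability 1/2, already puts the outcome
  -- below b.
  have h3 : capturedMass ρ σ b z + (stdGaussian.prod stdGaussian).real (Set.Ioc z z' ×ˢ Set.Iic 0)
      ≤ capturedMass ρ σ b z' := by
    rw [capturedMass, capturedMass, ← measureReal_union]
    · refine measureReal_mono ?_
      rintro p (⟨h, h'⟩ | ⟨h, h'⟩)
      · exact ⟨h.trans hz, h'⟩
      · refine ⟨h.2, ?_⟩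
        have := mul_le_mul_of_nonneg_left h.2 hρ
        have := mul_nonpos_of_nonneg_of_nonpos hσ h'
        linarith
    · rw [Set.disjoint_left]
      rintro p ⟨h, -⟩ ⟨h', -⟩
      exact absurd h (not_le.2 h'.1)
    · exact measurableSet_Ioc.prod measurableSet_Iic
  rw [h1]
  linarith

/-- Neyman–Pearson: among the sets of predictions of a given mass, a lower half-line captures the
most of the worst-off. -/
lemma real_le_capturedMass {ρ σ b z : ℝ} (hρ : 0 ≤ ρ) {S : Set ℝ}
    (hS : MeasurableSet S) (hSz : stdGaussian.real S ≤ cdf stdGaussian z) :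
    (stdGaussian.prod stdGaussian).real {p | p.1 ∈ S ∧ ρ * p.1 + σ * p.2 ≤ b} ≤
      capturedMass ρ σ b z := by
  set Q := stdGaussian.prod stdGaussian
  set L := {p : ℝ × ℝ | ρ * p.1 + σ * p.2 ≤ b} with hL
  have hLm : MeasurableSet L := measurableSet_le (by fun_prop) (by fun_prop)
  -- Exchange argument: the section of L at x shrinks as x grows and equals A at x = z. It is thus
  -- inside A for x ∈ S beyond z, and contains A for x ≤ z outside S; the latter set has at least
  -- the mass of the former.
  set A := {w : ℝ | ρ * z + σ * w ≤ b}
  have e1 : Q.real {p | p.1 ∈ S ∧ ρ * p.1 + σ * p.2 ≤ b} =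
      Q.real ((Prod.fst ⁻¹' (S ∩ Set.Iic z)) ∩ L) + Q.real ((Prod.fst ⁻¹' (S \ Set.Iic z)) ∩ L) := by
    rw [← measureReal_union]
    · congr 1
      ext p
      simp only [Set.mem_union, Set.mem_inter_iff, Set.mem_preimage, Set.mem_sdiff, hL,
        Set.mem_ofPred_eq]
      tauto
    · rw [Set.disjoint_left]
      rintro p ⟨h, -⟩ ⟨h', -⟩
      exact h'.2 h.2
    · exact (measurable_fst (hS.diff measurableSet_Iic)).inter hLm
  have e2 : capturedMass ρ σ b z =
      Q.real ((Prod.fst ⁻¹' (S ∩ Set.Iic z)) ∩ L) + Q.real ((Prod.fst ⁻¹' (Set.Iic z \ S)) ∩ L) := by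
    rw [capturedMass, ← measureReal_union]
    · congr 1
      ext p
      simp only [Set.mem_union, Set.mem_inter_iff, Set.mem_preimage, Set.mem_sdiff, hL,
        Set.mem_ofPred_eq, Set.mem_Iic]
      tauto
    · rw [Set.disjoint_left]
      rintro p ⟨h, -⟩ ⟨h', -⟩
      exact h'.2 h.1
    · exact (measurable_fst (measurableSet_Iic.diff hS)).inter hLm
  have e3 : Q.real ((Prod.fst ⁻¹' (S \ Set.Iic z)) ∩ L) ≤
      stdGaussian.real (S \ Set.Iic z) * stdGaussian.real A := by
    rw [← measureReal_prod_prod]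
    refine measureReal_mono ?_
    rintro p ⟨h, h'⟩
    refine ⟨h, ?_⟩
    have h1 : z ≤ p.1 := (not_le.1 h.2).le
    have := mul_le_mul_of_nonneg_left h1 hρ
    have h2 : ρ * p.1 + σ * p.2 ≤ b := h'
    change ρ * z + σ * p.2 ≤ b
    linarith
  have e4 : stdGaussian.real (Set.Iic z \ S) * stdGaussian.real A ≤
      Q.real ((Prod.fst ⁻¹' (Set.Iic z \ S)) ∩ L) := by
    rw [← measureReal_prod_prod]
    refine measureReal_mono ?_
    rintro p ⟨h, h'⟩
    refine ⟨h, ?_⟩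
    have := mul_le_mul_of_nonneg_left (show p.1 ≤ z from h.1) hρ
    have h2 : ρ * z + σ * p.2 ≤ b := h'
    change ρ * p.1 + σ * p.2 ≤ b
    linarith
  have e5 : stdGaussian.real (S \ Set.Iic z) ≤ stdGaussian.real (Set.Iic z \ S) := by
    rw [cdf_eq_real] at hSz
    have h1 := measureReal_inter_add_sdiff (μ := stdGaussian) (s := S) (measurableSet_Iic (a := z))
    have h2 := measureReal_inter_add_sdiff (μ := stdGaussian) (s := Set.Iic z) hS
    rw [Set.inter_comm] at h2
    linarith
  have e6 := mul_le_mul_of_nonneg_right e5 (measureReal_nonneg (μ := stdGaussian) (s := A))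
  linarith

/-! ### Reduction of a Gaussian model to the standard pair. -/

section

variable {Ω : Type*} [MeasurableSpace Ω] {P : Measure Ω} {Y Yhat : Ω → ℝ}

lemma memLp_two_of_map_eq_gaussianReal {X : Ω → ℝ} (hX : Measurable X) {μ : ℝ} {v : NNReal}
    (h : P.map X = gaussianReal μ v) : MemLp X 2 P := by
  have := (memLp_map_measure_iff (f := X) (μ := P) (g := id) (p := 2)
    measurable_id.aestronglyMeasurable hX.aemeasurable).1 (by
      rw [h]; exact memLp_id_gaussianReal' 2 (by simp))
  simpa using this

lemma variance_of_map_eq_gaussianReal {X : Ω → ℝ} (hX : Measurable X) {μ : ℝ} {v : NNReal}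
    (h : P.map X = gaussianReal μ v) : variance X P = v := by
  have := variance_map (μ := P) (X := id) (Y := X) measurable_id.aemeasurable hX.aemeasurable
  rw [h, variance_id_gaussianReal] at this
  exact this.symm

variable [IsProbabilityMeasure P]

/-- In a Gaussian model, `R²` determines how the variance of the outcome splits into the variance
of the prediction and that of the error. -/
lemma IsGaussianModel.variance_split (h : IsGaussianModel P Y Yhat) {μ : ℝ} {η γ : NNReal}
    (hη : 0 < η) (hY : P.map Y = gaussianReal μ (η ^ 2))
    (hE : P.map (fun ω => Y ω - Yhat ω) = gaussianReal 0 (γ ^ 2)) :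
    (γ : ℝ) ^ 2 = (1 - rSquared P Y Yhat) * (η : ℝ) ^ 2 := by
  have mE : Measurable (fun ω => Y ω - Yhat ω) :=
    h.measurable_outcome.sub h.measurable_prediction
  have lY := memLp_two_of_map_eq_gaussianReal h.measurable_outcome hY
  have lE := memLp_two_of_map_eq_gaussianReal mE hE
  have vY := variance_of_map_eq_gaussianReal h.measurable_outcome hY
  have vE := variance_of_map_eq_gaussianReal mE hE
  have e : Y = (fun ω => Y ω - Yhat ω) + Yhat := by ext; simp
  have lH : MemLp Yhat 2 P := by
    have := lY.sub lE
    convert! this using 1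
    ext; simp
  have hv : variance Y P = variance (fun ω => Y ω - Yhat ω) P + variance Yhat P := by
    nth_rewrite 1 [e]
    exact h.error_indep.variance_add lE lH
  -- By independence of the error, R² is the ratio of the variances of Ŷ and Y.
  have hc : covariance Y Yhat P = variance Yhat P := by
    nth_rewrite 1 [e]
    rw [covariance_add_left lE lH lH, h.error_indep.covariance_eq_zero lE lH,
      covariance_self h.measurable_prediction.aemeasurable, zero_add]
  have hη' : (0 : ℝ) < η := hη
  have hv0 := variance_nonneg Yhat P
  rw [vE] at hv
  rw [rSquared, hc, hv, div_pow, mul_pow, Real.sq_sqrt hv0, ← hv, vY]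
  rw [vY] at hv
  push_cast at hv ⊢
  rw [Real.sq_sqrt (by positivity)]
  -- For a constant prediction the correlation is 0/0 = 0, and the formula persists.
  rcases hv0.eq_or_lt with h0 | h0
  · rw [← h0] at hv ⊢
    simp only [ne_eq, OfNat.ofNat_ne_zero, not_false_eq_true, zero_pow, zero_div, sub_zero, one_mul]
    linarith
  · field_simp
    linarith

lemma IsGaussianModel.exists_law (h : IsGaussianModel P Y Yhat) {r : ℝ}
    (hr : rSquared P Y Yhat = r) (hr0 : 0 < r) :
    r ≤ 1 ∧ ∃ (μ : ℝ) (η : NNReal), 0 < η ∧ P.map Y = gaussianReal μ (η ^ 2) ∧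
      P.map (fun ω => (Yhat ω, Y ω)) = (stdGaussian.prod stdGaussian).map (fun p =>
        (μ + η * (Real.sqrt r * p.1), μ + η * (Real.sqrt r * p.1 + Real.sqrt (1 - r) * p.2))) := by
  obtain ⟨μ, η, hη, hY⟩ := h.outcome_law
  obtain ⟨γ, hE⟩ := h.error_law
  have hs := h.variance_split hη hY hE
  rw [hr] at hs
  have hη' : (0 : ℝ) < η := hη
  have hr1 : r ≤ 1 := by
    by_contra! hlt
    have : (1 - r) * (η : ℝ) ^ 2 < 0 := mul_neg_of_neg_of_pos (by linarith) (by positivity)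
    nlinarith [sq_nonneg (γ : ℝ)]
  refine ⟨hr1, μ, η, hη, hY, ?_⟩
  have mH := h.measurable_prediction
  have mE : Measurable (fun ω => Y ω - Yhat ω) := h.measurable_outcome.sub mH
  have hγ : (γ : ℝ) = Real.sqrt (1 - r) * η := by
    rw [← Real.sqrt_sq γ.coe_nonneg, hs, Real.sqrt_mul (by linarith), Real.sqrt_sq hη'.le]
  -- The model does not assume that Ŷ is normal. The characteristic function of Y is the product of
  -- those of the error and of Ŷ, and the error's factor never vanishes and can be cancelled.
  have hH : P.map Yhat = gaussianReal μ (((Real.sqrt r).toNNReal * η) ^ 2) := by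
    have := Measure.isProbabilityMeasure_map (μ := P) mH.aemeasurable
    refine Measure.ext_of_charFun (funext fun t => ?_)
    have hsum := congrFun (h.error_indep.charFun_map_fun_add_eq_mul mE.aemeasurable
      mH.aemeasurable) t
    simp only [sub_add_cancel, Pi.mul_apply] at hsum
    change charFun (P.map Y) t = _ at hsum
    rw [hY, hE, charFun_gaussianReal, charFun_gaussianReal] at hsum
    rw [charFun_gaussianReal]
    refine mul_left_cancel₀ (Complex.exp_ne_zero _) (hsum.symm.trans ?_)
    rw [← Complex.exp_add]
    congr 1
    have h1 : ((γ ^ 2 : NNReal) : ℂ) = (((1 - r) * (η : ℝ) ^ 2 : ℝ) : ℂ) := by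
      rw [← hs]; norm_cast
    have h2 : ((((Real.sqrt r).toNNReal * η) ^ 2 : NNReal) : ℂ) = ((r * (η : ℝ) ^ 2 : ℝ) : ℂ) := by
      conv_rhs => rw [← Real.sq_sqrt hr0.le]
      push_cast
      rw [Real.coe_toNNReal _ (Real.sqrt_nonneg r)]
      ring
    change _ = (_ * _ * Complex.I - ((γ ^ 2 : NNReal) : ℂ) * _ / 2) +
      (_ - ((((Real.sqrt r).toNNReal * η) ^ 2 : NNReal) : ℂ) * _ / 2)
    rw [h1, h2]
    push_cast
    ring
  have hjoint : P.map (fun ω => (Yhat ω, Y ω - Yhat ω)) =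
      (stdGaussian.prod stdGaussian).map
        (Prod.map (fun x => μ + ((Real.sqrt r).toNNReal * η : NNReal) * x)
          (fun x => 0 + (γ : ℝ) * x)) := by
    rw [h.error_indep.symm.map_prod_eq_prod_map_map mH.aemeasurable mE.aemeasurable, hH, hE,
      gaussianReal_eq_map_stdGaussian, gaussianReal_eq_map_stdGaussian,
      Measure.map_prod_map _ _ (by fun_prop) (by fun_prop)]
  have e : (fun ω => (Yhat ω, Y ω)) =
      (fun p : ℝ × ℝ => (p.1, p.1 + p.2)) ∘ (fun ω => (Yhat ω, Y ω - Yhat ω)) := by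
    ext ω <;> simp
  rw [e, ← Measure.map_map (by fun_prop) (by fun_prop), hjoint,
    Measure.map_map (by fun_prop) (by fun_prop)]
  congr 1
  ext p
  · simp only [Function.comp, Prod.map, NNReal.coe_mul, Real.coe_toNNReal _ (Real.sqrt_nonneg r)]
    ring
  · simp only [Function.comp, Prod.map, NNReal.coe_mul, Real.coe_toNNReal _ (Real.sqrt_nonneg r),
      hγ]
    ring

/-- The policy value is attained by screening below a threshold of the prediction. -/
lemma IsGaussianModel.policyValue_eq (h : IsGaussianModel P Y Yhat) {r a b : ℝ}
    (hr : rSquared P Y Yhat = r) (hr0 : 0 < r) (ha0 : 0 < a) (ha1 : a < 1) (hb0 : 0 < b)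
    (hb1 : b < 1) :
    policyValue P Y Yhat a b = capturedMass (Real.sqrt r) (Real.sqrt (1 - r))
      (stdNormalQuantile b) (stdNormalQuantile a) / b := by
  obtain ⟨hr1, μ, η, hη, hY, hlaw⟩ := h.exists_law hr hr0
  have hη' : (0 : ℝ) < η := hη
  have hs : 0 < Real.sqrt r := Real.sqrt_pos.2 hr0
  have mY := h.measurable_outcome
  have mH := h.measurable_prediction
  set q := stdNormalQuantile b with hq
  have hQ : quantile (P.map Y) b = μ + η * q := by
    rw [hY, quantile_gaussianReal μ hη hb0 hb1]
  have hW : worstOff P Y b = Y ⁻¹' Set.Iic (μ + η * q) := by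
    rw [worstOff, hQ]; rfl
  have hPW : P.real (worstOff P Y b) = b := by
    rw [hW, ← map_measureReal_apply mY measurableSet_Iic, hY, gaussianReal_eq_map_stdGaussian,
      map_measureReal_apply (by fun_prop) measurableSet_Iic]
    have : (fun x : ℝ => μ + η * x) ⁻¹' Set.Iic (μ + η * q) = Set.Iic q := by
      ext x; simp [mul_le_mul_iff_right₀ hη']
    rw [this, ← cdf_eq_real, hq, cdf_stdNormalQuantile hb0 hb1]
  have hfeas : ∀ π : ℝ → Bool, Measurable π → P.real {ω | π (Yhat ω) = true} =
      stdGaussian.real {x | π (μ + η * (Real.sqrt r * x)) = true} := by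
    intro π hπ
    have hm : MeasurableSet {p : ℝ × ℝ | π p.1 = true} :=
      (hπ.comp measurable_fst) (measurableSet_singleton true)
    have h1 : P.real {ω | π (Yhat ω) = true} =
        (P.map (fun ω => (Yhat ω, Y ω))).real {p : ℝ × ℝ | π p.1 = true} := by
      rw [map_measureReal_apply (mH.prodMk mY) hm]
      rfl
    rw [h1, hlaw, map_measureReal_apply (by fun_prop) hm]
    have h2 : (fun p : ℝ × ℝ => (μ + η * (Real.sqrt r * p.1),
        μ + η * (Real.sqrt r * p.1 + Real.sqrt (1 - r) * p.2))) ⁻¹' {p : ℝ × ℝ | π p.1 = true} =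
        {x | π (μ + η * (Real.sqrt r * x)) = true} ×ˢ Set.univ := by
      ext p; simp
    rw [h2, measureReal_prod_prod]
    simp
  have hval : ∀ π : ℝ → Bool, Measurable π → screenedFraction P Y Yhat b π =
      (stdGaussian.prod stdGaussian).real {p | p.1 ∈ {x | π (μ + η * (Real.sqrt r * x)) = true} ∧
        Real.sqrt r * p.1 + Real.sqrt (1 - r) * p.2 ≤ q} / b := by
    intro π hπ
    have hm : MeasurableSet {p : ℝ × ℝ | p.2 ≤ μ + η * q ∧ π p.1 = true} :=
      (measurable_snd measurableSet_Iic).inter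
        ((hπ.comp measurable_fst) (measurableSet_singleton true))
    have h1 : P.real (worstOff P Y b ∩ {ω | π (Yhat ω) = true}) =
        (P.map (fun ω => (Yhat ω, Y ω))).real {p : ℝ × ℝ | p.2 ≤ μ + η * q ∧ π p.1 = true} := by
      rw [map_measureReal_apply (mH.prodMk mY) hm, hW]
      rfl
    rw [screenedFraction, measureReal_def, cond_apply (hW ▸ mY measurableSet_Iic),
      ENNReal.toReal_mul, ENNReal.toReal_inv, ← measureReal_def, ← measureReal_def, hPW, h1, hlaw,
      map_measureReal_apply (by fun_prop) hm, inv_mul_eq_div]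
    congr 2
    ext p
    simp only [Set.mem_preimage, Set.mem_ofPred_eq, add_le_add_iff_left,
      mul_le_mul_iff_right₀ hη']
    tauto
  set z := stdNormalQuantile a with hz
  have hdec : Measurable fun y : ℝ => decide (y ≤ μ + η * (Real.sqrt r * z)) := by
    refine measurable_to_bool ?_
    convert! measurableSet_Iic (a := μ + η * (Real.sqrt r * z)) using 1
    ext y; simp
  refine IsGreatest.csSup_eq ⟨?_, ?_⟩
  · refine ⟨fun y => decide (y ≤ μ + η * (Real.sqrt r * z)), ⟨hdec, ?_⟩, ?_⟩
    · rw [hfeas _ hdec]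
      simp only [decide_eq_true_eq, add_le_add_iff_left, mul_le_mul_iff_right₀ hη',
        mul_le_mul_iff_right₀ hs]
      have := cdf_stdNormalQuantile ha0 ha1
      rw [cdf_eq_real] at this
      exact this.le
    · rw [hval _ hdec, capturedMass]
      simp only [decide_eq_true_eq, add_le_add_iff_left, mul_le_mul_iff_right₀ hη',
        mul_le_mul_iff_right₀ hs, Set.mem_ofPred_eq]
  · rintro _ ⟨π, ⟨hπ, hπa⟩, rfl⟩
    rw [hval π hπ]
    rw [hfeas π hπ] at hπa
    refine div_le_div_of_nonneg_right (real_le_capturedMass hs.le ?_ ?_) hb0.le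
    · exact (hπ.comp (by fun_prop : Measurable fun x => μ + η * (Real.sqrt r * x)))
        (measurableSet_singleton true)
    · rwa [cdf_stdNormalQuantile ha0 ha1]

end

/-! ### Asymptotics on the scale s², where s = −Φ⁻¹(α). -/

lemma tendsto_quadratic_div_sq (A B C : ℝ) :
    Tendsto (fun s : ℝ => (A * s ^ 2 + B * s + C) / s ^ 2) atTop (𝓝 A) := by
  have h1 : Tendsto (fun s : ℝ => B * s⁻¹) atTop (𝓝 (B * 0)) := tendsto_inv_atTop_zero.const_mul B
  have h2 : Tendsto (fun s : ℝ => C * (s⁻¹) ^ 2) atTop (𝓝 (C * 0 ^ 2)) :=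
    (tendsto_inv_atTop_zero.pow 2).const_mul C
  have h := (h1.const_add A).add h2
  simp only [mul_zero, add_zero, ne_eq, OfNat.ofNat_ne_zero, not_false_eq_true, zero_pow] at h
  refine h.congr' ?_
  filter_upwards [eventually_gt_atTop 0] with s hs
  field_simp

lemma tendsto_neg_stdNormalQuantile :
    Tendsto (fun α => -stdNormalQuantile α) (𝓝[>] 0) atTop := by
  refine tendsto_atTop.2 fun M => ?_
  have h1 : (0 : ℝ) < cdf stdGaussian (-M) := cdf_stdGaussian_pos _
  filter_upwards [Ioo_mem_nhdsGT h1] with α hα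
  have h2 : α < 1 := hα.2.trans (cdf_stdGaussian_lt_one _)
  have := hα.2
  rw [← cdf_stdNormalQuantile hα.1 h2, strictMono_cdf_stdGaussian.lt_iff_lt] at this
  linarith

/-- Asymptotics of the normal quantile: `Φ⁻¹(α)² ∼ -2 log α` as `α ↓ 0`. -/
lemma tendsto_neg_log_div_sq_stdNormalQuantile :
    Tendsto (fun α => -Real.log α / (-stdNormalQuantile α) ^ 2) (𝓝[>] 0) (𝓝 (1 / 2)) := by
  have hs := tendsto_neg_stdNormalQuantile
  set c := (Real.sqrt (2 * Real.pi))⁻¹ with hc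
  have hc0 : 0 < c := by positivity
  have hup := (tendsto_quadratic_div_sq (1 / 2) 1 (1 / 2 - Real.log c)).comp hs
  have hlo : Tendsto (fun _ : ℝ => (1 / 2 : ℝ)) (𝓝[>] 0) (𝓝 (1 / 2)) := tendsto_const_nhds
  refine tendsto_of_tendsto_of_tendsto_of_le_of_le' hlo hup ?_ ?_ <;>
    filter_upwards [hs.eventually_gt_atTop 0, Ioo_mem_nhdsGT (one_pos (α := ℝ))] with α h0 hα
  · have h := cdf_stdGaussian_neg_le h0.le
    rw [neg_neg, cdf_stdNormalQuantile hα.1 hα.2] at h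
    have := Real.log_le_log hα.1 h
    rw [Real.log_exp] at this
    rw [le_div_iff₀ (by positivity)]
    linarith
  · have h := le_cdf_stdGaussian_neg h0.le
    rw [neg_neg, cdf_stdNormalQuantile hα.1 hα.2, ← hc] at h
    have := Real.log_le_log (by positivity) h
    rw [Real.log_mul hc0.ne' (Real.exp_pos _).ne', Real.log_exp] at this
    simp only [Function.comp]
    gcongr
    linarith

/-- The factors c and s contribute only log c + log s = o(s²), so any positive constant, such as
5.1, gives the same limit. -/
lemma tendsto_log_mul_div_sq_stdNormalQuantile {c : ℝ} (hc : 0 < c) :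
    Tendsto (fun α => Real.log (c * α * -stdNormalQuantile α) / (-stdNormalQuantile α) ^ 2)
      (𝓝[>] 0) (𝓝 (-(1 / 2))) := by
  have hs := tendsto_neg_stdNormalQuantile
  have h1 := tendsto_neg_log_div_sq_stdNormalQuantile
  have h2 := (tendsto_quadratic_div_sq 0 0 (Real.log c)).comp hs
  have h3 : Tendsto (fun s : ℝ => Real.log s / s ^ 2) atTop (𝓝 0) :=
    (isLittleO_log_rpow_atTop (zero_lt_two)).tendsto_div_nhds_zero.congr fun s => by simp
  have h := (h2.sub h1).add (h3.comp hs)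
  rw [show (0 : ℝ) - 1 / 2 + 0 = -(1 / 2) by norm_num] at h
  refine h.congr' ?_
  filter_upwards [hs.eventually_gt_atTop 0, self_mem_nhdsWithin] with α h0 hα
  have hα' : (0 : ℝ) < α := hα
  rw [Real.log_mul (by positivity) h0.ne', Real.log_mul hc.ne' hα'.ne']
  simp only [Function.comp]
  ring

/-- The exponent in the Gaussian upper bound for `wastedMass ρ σ b (-s)`. -/
noncomputable def wastedExponent (ρ σ b s : ℝ) : ℝ :=
  s ^ 2 / 2 + ((b + ρ * s) / σ) ^ 2 / 2

lemma wastedMass_le_exp {ρ σ b s : ℝ} (hρ : 0 ≤ ρ) (hσ : 0 < σ) (hs : 0 ≤ s)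
    (hb : 0 ≤ b + ρ * s) : wastedMass ρ σ b (-s) ≤ Real.exp (-wastedExponent ρ σ b s) := by
  refine (wastedMass_le hρ hσ hs hb).trans_eq ?_
  rw [← Real.exp_add, wastedExponent]
  congr 1
  ring

/-- Source of the exponent in the theorem: 1 + r/(1 − r) = 1/(1 − r). -/
lemma tendsto_wastedExponent_div_sq (b : ℝ) {r : ℝ} (hr0 : 0 < r) (hr1 : r < 1) :
    Tendsto (fun s => wastedExponent (Real.sqrt r) (Real.sqrt (1 - r)) b s / s ^ 2) atTop
      (𝓝 (1 / (1 - r) / 2)) := by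
  have h1 : 0 < 1 - r := by linarith
  refine (tendsto_quadratic_div_sq (1 / (1 - r) / 2) (b * Real.sqrt r / (1 - r))
    (b ^ 2 / (1 - r) / 2)).congr fun s => ?_
  congr 1
  rw [wastedExponent, div_pow, Real.sq_sqrt h1.le, add_sq, mul_pow, Real.sq_sqrt hr0.le]
  field_simp
  ring

/-- The exponent of the lower bound `le_wastedMass`, constants included, has s² coefficient 1/(2(1 −
r)), so any f with a larger coefficient overtakes it. -/
lemma eventually_exp_lt_wastedMass (b : ℝ) {r k : ℝ} (hr0 : 0 < r) (hr1 : r < 1)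
    (hk : 1 / (1 - r) / 2 < k) {f : ℝ → ℝ} (hf : Tendsto (fun s => f s / s ^ 2) atTop (𝓝 k)) :
    ∀ᶠ s in atTop,
      Real.exp (-f s) < wastedMass (Real.sqrt r) (Real.sqrt (1 - r)) b (-s) := by
  have h1 : 0 < 1 - r := by linarith
  have hσ : 0 < Real.sqrt (1 - r) := Real.sqrt_pos.2 h1
  have hρ : 0 < Real.sqrt r := Real.sqrt_pos.2 hr0
  set σ := Real.sqrt (1 - r) with hσd
  set ρ := Real.sqrt r with hρd
  set c := (Real.sqrt (2 * Real.pi))⁻¹ with hc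
  have hc0 : 0 < c := by positivity
  have hlow : Tendsto (fun s => ((s + 1) ^ 2 / 2 + ((b + ρ * (s + 1)) / σ + 1) ^ 2 / 2
      - 2 * Real.log c) / s ^ 2) atTop (𝓝 (1 / (1 - r) / 2)) := by
    refine (tendsto_quadratic_div_sq (1 / (1 - r) / 2) (1 + ρ * ((b + ρ) / σ + 1) / σ)
      (1 / 2 + ((b + ρ) / σ + 1) ^ 2 / 2 - 2 * Real.log c)).congr fun s => ?_
    congr 1
    have e : 1 / (1 - r) = 1 + (ρ / σ) ^ 2 := by
      rw [div_pow, hσd, hρd, Real.sq_sqrt h1.le, Real.sq_sqrt hr0.le]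
      field_simp
      ring
    rw [e]
    field_simp
    ring
  have hd := hf.sub hlow
  filter_upwards [hd.eventually_const_lt (sub_pos.2 hk), eventually_gt_atTop 0,
    eventually_ge_atTop (-b / ρ)] with s hs h0 hb
  rw [← sub_div, lt_div_iff₀ (by positivity), zero_mul] at hs
  rw [div_le_iff₀ hρ] at hb
  refine lt_of_lt_of_le ?_ (le_wastedMass hρ.le hσ h0.le (by linarith))
  rw [← hc]
  have : c * Real.exp (-(s + 1) ^ 2 / 2) * (c * Real.exp (-((b + ρ * (s + 1)) / σ + 1) ^ 2 / 2)) =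
      Real.exp (-((s + 1) ^ 2 / 2 + ((b + ρ * (s + 1)) / σ + 1) ^ 2 / 2 - 2 * Real.log c)) := by
    nth_rewrite 1 2 [← Real.exp_log hc0]
    rw [← Real.exp_add, ← Real.exp_add, ← Real.exp_add]
    congr 1
    ring
  rw [this, Real.exp_lt_exp]
  linarith

/-- Far in the tail, a better prediction wastes strictly less of the screening capacity. -/
lemma eventually_wastedMass_lt (b : ℝ) {r r' : ℝ} (hr0 : 0 < r) (hrr' : r < r') (hr' : r' ≤ 1) :
    ∀ᶠ s in atTop, wastedMass (Real.sqrt r') (Real.sqrt (1 - r')) b (-s) <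
      wastedMass (Real.sqrt r) (Real.sqrt (1 - r)) b (-s) := by
  have hr1 : r < 1 := hrr'.trans_le hr'
  rcases hr'.eq_or_lt with rfl | hlt
  -- A perfect prediction wastes nothing once −s ≤ b; this auxiliary f only serves to show that the
  -- waste for r is positive.
  · have hf : Tendsto (fun s : ℝ => ((1 / (1 - r) / 2 + 1) * s ^ 2 + 0 * s + 0) / s ^ 2) atTop _ :=
      tendsto_quadratic_div_sq _ _ _
    filter_upwards [eventually_exp_lt_wastedMass b hr0 hr1 (by linarith) hf,
      eventually_ge_atTop (-b)] with s hs hb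
    rw [Real.sqrt_one, sub_self, Real.sqrt_zero, wastedMass_one_zero (by linarith)]
    exact (Real.exp_pos _).trans hs
  · have hρ : 0 < Real.sqrt r' := Real.sqrt_pos.2 (hr0.trans hrr')
    have hk : 1 / (1 - r) / 2 < 1 / (1 - r') / 2 := by
      have : 0 < 1 - r' := by linarith
      gcongr
    filter_upwards [eventually_exp_lt_wastedMass b hr0 hr1 hk
      (tendsto_wastedExponent_div_sq b (hr0.trans hrr') hlt), eventually_ge_atTop 0,
      eventually_ge_atTop (-b / Real.sqrt r')] with s hs h0 hb
    rw [div_le_iff₀ hρ] at hb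
    refine (wastedMass_le_exp hρ.le (Real.sqrt_pos.2 (by linarith)) h0 (by linarith)).trans_lt hs

/-! ### Lower bound for the ratio in terms of the wasted mass. -/

section

variable {Ω : Type*} [MeasurableSpace Ω] {P : Measure Ω} [IsProbabilityMeasure P]
  {Y Yhat Yhat' : Ω → ℝ}

lemma IsGaussianModel.predictionAccessRatio_ge (h : IsGaussianModel P Y Yhat)
    (h' : IsGaussianModel P Y Yhat') {r r' α Δα β : ℝ} (hr : rSquared P Y Yhat = r)
    (hr' : rSquared P Y Yhat' = r') (hr0 : 0 < r) (hr0' : 0 < r') (hβ0 : 0 < β) (hβ1 : β < 1)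
    (hα : 0 < α) (hΔ : 0 < Δα) (hlt : α + Δα < 1)
    (hb : Real.sqrt r * stdNormalQuantile (α + Δα) ≤ stdNormalQuantile β)
    (hmiss : wastedMass (Real.sqrt r') (Real.sqrt (1 - r')) (stdNormalQuantile β)
      (stdNormalQuantile α) < wastedMass (Real.sqrt r) (Real.sqrt (1 - r)) (stdNormalQuantile β)
      (stdNormalQuantile α)) :
    0 < policyValue P Y Yhat' α β - policyValue P Y Yhat α β ∧
      Δα / (2 * wastedMass (Real.sqrt r) (Real.sqrt (1 - r)) (stdNormalQuantile β)
        (stdNormalQuantile α)) ≤ predictionAccessRatio P Y Yhat Yhat' α Δα β := by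
  have hα1 : α < 1 := by linarith
  rw [predictionAccessRatio, h.policyValue_eq hr hr0 hα hα1 hβ0 hβ1,
    h.policyValue_eq hr hr0 (by linarith) hlt hβ0 hβ1, h'.policyValue_eq hr' hr0' hα hα1 hβ0 hβ1]
  set b := stdNormalQuantile β
  set z := stdNormalQuantile α with hz
  set z' := stdNormalQuantile (α + Δα) with hz'
  have cz : cdf stdGaussian z = α := cdf_stdNormalQuantile hα hα1
  have cz' : cdf stdGaussian z' = α + Δα := cdf_stdNormalQuantile (by linarith) hlt
  have hzz : z ≤ z' := by
    rw [← strictMono_cdf_stdGaussian.le_iff_le, cz, cz']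
    linarith
  have h1 := capturedMass_sub_ge (σ := Real.sqrt (1 - r)) (Real.sqrt_nonneg r)
    (Real.sqrt_nonneg _) hzz hb
  have h2 := capturedMass_add_wastedMass (Real.sqrt r) (Real.sqrt (1 - r)) b z
  have h3 := capturedMass_add_wastedMass (Real.sqrt r') (Real.sqrt (1 - r')) b z
  have h4 := wastedMass_nonneg (Real.sqrt r') (Real.sqrt (1 - r')) b z
  rw [cz, cz'] at h1
  rw [← sub_div, ← sub_div, div_div_div_cancel_right₀ hβ0.ne']
  refine ⟨div_pos (by linarith) hβ0, ?_⟩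
  rw [← div_div]
  exact div_le_div₀ (by linarith) (by linarith) (by linarith) (by linarith)

end

end Screening

/-! ### Choice of t, e and a, and conclusion. -/

theorem mainTheorem1 (β R2 ΔR2 : ℝ) (hβ : 0 < β) (hβ' : β ≤ 1 / 2)
    (hR2 : 0 < R2) (hR2' : R2 < 1) (hΔR2 : 0 < ΔR2) (hsum : R2 + ΔR2 ≤ 1) :
    ∃ (t : ℝ) (e : ℝ → ℝ) (a : ℝ → ℝ),
      0 < t ∧ t < 1 / 2 ∧ Tendsto e (𝓝[>] 0) (𝓝 0) ∧ (∀ δ : ℝ, 0 < δ → 0 < a δ) ∧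
      ∀ (Ω : Type*) [MeasurableSpace Ω] (P : Measure Ω) [IsProbabilityMeasure P]
        (Y Yhat Yhat' : Ω → ℝ),
        Screening.IsGaussianModel P Y Yhat → Screening.rSquared P Y Yhat = R2 →
        Screening.IsGaussianModel P Y Yhat' → Screening.rSquared P Y Yhat' = R2 + ΔR2 →
        ∀ α Δα : ℝ, 0 < α → 0 < Δα → α + Δα ≤ t →
          0 < Screening.policyValue P Y Yhat' α β - Screening.policyValue P Y Yhat α β ∧
          Δα / ΔR2 * Real.sqrt (R2 * (1 - R2)) *
              (5.1 * α * Screening.stdNormalQuantile (1 - α)) ^ (-(1 / (1 - R2)) + e α)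
            ≤ Screening.predictionAccessRatio P Y Yhat Yhat' α Δα β ∧
          ∀ δ : ℝ, 0 < δ → α ≤ a δ →
            Δα / ΔR2 * (1 / α) ^ (1 / (1 - R2) - δ)
              ≤ Screening.predictionAccessRatio P Y Yhat Yhat' α Δα β := by
  open Screening in
  set ρ := Real.sqrt R2 with hρd
  set σ := Real.sqrt (1 - R2) with hσd
  have hρ : 0 < ρ := Real.sqrt_pos.2 hR2
  have hσ : 0 < σ := Real.sqrt_pos.2 (by linarith)
  set b := stdNormalQuantile β with hb
  set k := 1 / (1 - R2) with hk
  set K := Real.sqrt (R2 * (1 - R2)) / ΔR2 with hK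
  have hK0 : 0 < K := div_pos (Real.sqrt_pos.2 (mul_pos hR2 (by linarith))) hΔR2
  set s : ℝ → ℝ := fun α => -stdNormalQuantile α with hs
  set h : ℝ → ℝ := fun α => wastedExponent ρ σ b (s α) with hh
  set u : ℝ → ℝ := fun α => 5.1 * α * s α with hu
  have ts : Tendsto s (𝓝[>] 0) atTop := tendsto_neg_stdNormalQuantile
  have th : Tendsto (fun α => h α / s α ^ 2) (𝓝[>] 0) (𝓝 (k / 2)) :=
    (tendsto_wastedExponent_div_sq b hR2 hR2').comp ts
  have tconst : ∀ C : ℝ, Tendsto (fun α => C / s α ^ 2) (𝓝[>] 0) (𝓝 0) := fun C =>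
    ((tendsto_quadratic_div_sq 0 0 C).comp ts).congr fun α => by simp
  have tu : Tendsto (fun α => Real.log (u α) / s α ^ 2) (𝓝[>] 0) (𝓝 (-(1 / 2))) :=
    tendsto_log_mul_div_sq_stdNormalQuantile (by norm_num)
  have tl : Tendsto (fun α => -Real.log α / s α ^ 2) (𝓝[>] 0) (𝓝 (1 / 2)) :=
    tendsto_neg_log_div_sq_stdNormalQuantile
  have eve : ∀ᶠ α in 𝓝[>] (0 : ℝ), 0 < s α ∧ 0 ≤ b + ρ * s α ∧ Real.log (u α) < 0 ∧
      wastedMass (Real.sqrt (R2 + ΔR2)) (Real.sqrt (1 - (R2 + ΔR2))) b (-s α) <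
        wastedMass ρ σ b (-s α) := by
    filter_upwards [ts.eventually_gt_atTop 0, ts.eventually_ge_atTop (-b / ρ),
      tu.eventually_lt_const (by norm_num : -(1 / 2 : ℝ) < 0),
      ts.eventually (eventually_wastedMass_lt b hR2 (by linarith) hsum)] with α h0 h1 h2 h3
    rw [div_le_iff₀ hρ] at h1
    rw [div_lt_iff₀ (by positivity), zero_mul] at h2
    exact ⟨h0, by linarith, h2, h3⟩
  obtain ⟨t₀, ht₀, hev⟩ := mem_nhdsGT_iff_exists_Ioo_subset.1 eve
  have ht₀' : (0 : ℝ) < t₀ := ht₀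
  -- Divided by s², the difference of the two sides tends to k/2 − (k − δ)/2 = δ/2 > 0. The constant
  -- log(2/ΔR2) absorbs the prefactors of the polynomial bound.
  have key : ∀ δ : ℝ, ∃ a : ℝ, 0 < δ → 0 < a ∧ ∀ α ∈ Set.Ioc 0 a,
      (k - δ) * -Real.log α ≤ h α - Real.log (2 / ΔR2) := by
    intro δ
    by_cases hδ : 0 < δ
    · have hlim := (th.sub (tconst (Real.log (2 / ΔR2)))).sub (tl.const_mul (k - δ))
      have hpos : 0 < k / 2 - 0 - (k - δ) * (1 / 2) := by linarith
      have hev' : ∀ᶠ α in 𝓝[>] (0 : ℝ), (k - δ) * -Real.log α ≤ h α - Real.log (2 / ΔR2) := by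
        filter_upwards [hlim.eventually_const_lt hpos, ts.eventually_gt_atTop 0] with α h1 h0
        rw [← sub_div, ← mul_div_assoc, ← sub_div, lt_div_iff₀ (by positivity), zero_mul] at h1
        linarith
      obtain ⟨a, ha, hsub⟩ := mem_nhdsGT_iff_exists_Ioc_subset.1 hev'
      exact ⟨a, fun _ => ⟨ha, hsub⟩⟩
    · exact ⟨1, fun hδ' => absurd hδ' hδ⟩
  choose a ha using key
  -- The error e solves K · u^(−k+e) = exp(h)/2, so the claimed bound is exactly Δα · exp(h)/2 and
  -- only e → 0 needs proof. Halving t₀ keeps α + Δα inside the open interval.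
  refine ⟨min (t₀ / 2) (1 / 4), fun α => k + (h α - Real.log (2 * K)) / Real.log (u α), a,
    by positivity, (min_le_right _ _).trans_lt (by norm_num), ?_, fun δ hδ => (ha δ hδ).1, ?_⟩
  · have := ((th.sub (tconst (Real.log (2 * K)))).div tu (by norm_num)).const_add k
    rw [show k + (k / 2 - 0) / (-(1 / 2)) = 0 by ring] at this
    refine this.congr' ?_
    filter_upwards [ts.eventually_gt_atTop 0] with α h0
    simp only [Pi.div_apply]
    rw [← sub_div, div_div_div_cancel_right₀ (by positivity)]
  intro Ω _ P _ Y Yhat Yhat' hM hr hM' hr' α Δα hα hΔ ht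
  have hα₀ : α + Δα < t₀ := by linarith [ht.trans (min_le_left _ _)]
  have hα₁ : α + Δα ≤ 1 / 4 := ht.trans (min_le_right _ _)
  obtain ⟨h0, h1, h2, h3⟩ := hev ⟨hα, by linarith⟩
  -- The half-capture bound needs ρz' ≤ b at the raised threshold, hence the second use of `hev`, at
  -- α + Δα.
  obtain ⟨-, g1, -, -⟩ := hev (⟨by linarith, hα₀⟩ : α + Δα ∈ Set.Ioo 0 t₀)
  simp only [hs, neg_neg, mul_neg] at h3 g1
  obtain ⟨hden, hpar⟩ := hM.predictionAccessRatio_ge hM' hr hr' hR2 (by linarith) hβ (by linarith)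
    hα hΔ (by linarith) (by linarith) h3
  have hmiss : wastedMass ρ σ b (stdNormalQuantile α) ≤ Real.exp (-h α) := by
    have := wastedMass_le_exp hρ.le hσ h0.le h1
    rwa [hs, neg_neg] at this
  have hexp : Δα * (Real.exp (h α) / 2) ≤ predictionAccessRatio P Y Yhat Yhat' α Δα β := by
    refine le_trans ?_ hpar
    have hpos := (wastedMass_nonneg _ _ _ _).trans_lt h3
    rw [le_div_iff₀ (by positivity)]
    have : Real.exp (h α) * wastedMass ρ σ b (stdNormalQuantile α) ≤ 1 := by
      refine (mul_le_mul_of_nonneg_left hmiss (Real.exp_pos _).le).trans_eq ?_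
      rw [← Real.exp_add, add_neg_cancel, Real.exp_zero]
    nlinarith
  refine ⟨hden, ?_, ?_⟩
  · refine le_trans (le_of_eq ?_) hexp
    rw [stdNormalQuantile_one_sub hα (by linarith)]
    have hupos : 0 < u α := by positivity
    change _ * (u α) ^ _ = _
    rw [Real.rpow_def_of_pos hupos, neg_add_cancel_left, mul_div_cancel₀ _ h2.ne, Real.exp_sub,
      Real.exp_log (by positivity), hK]
    have : Real.sqrt (R2 * (1 - R2)) ≠ 0 := (Real.sqrt_pos.2 (mul_pos hR2 (by linarith))).ne'
    field_simp
  · intro δ hδ hαa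
    refine le_trans ?_ hexp
    have := (ha δ hδ).2 α ⟨hα, hαa⟩
    rw [Real.rpow_def_of_pos (by positivity), one_div, Real.log_inv, mul_comm (-Real.log α)]
    have h5 := Real.exp_le_exp.2 this
    rw [Real.exp_sub, Real.exp_log (by positivity)] at h5
    calc Δα / ΔR2 * Real.exp ((k - δ) * -Real.log α)
        ≤ Δα / ΔR2 * (Real.exp (h α) / (2 / ΔR2)) := by gcongr
      _ = Δα * (Real.exp (h α) / 2) := by field_simp
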